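/- Let $C$ be a coalgebra over a field $k$, with comultiplication $\Delta$. Call a left (right) $C$-comodule distributive if its lattice of subcomodules is distributive, and call $C$ distributive if $C$ is distributive as a left or as a right comodule over itself. The quiver $\Gamma_C$ has the simple subcoalgebras of $C$ as vertices, and it has one arrow from $S_1$ to $S_2$ if $S_2\wedge S_1\neq S_1+S_2$ and none otherwise, where $U\wedge V=\Delta^{-1}(U\otimes C+C\otimes V)$. Proposition. Let $C$ be a distributive coalgebra. Then $\Gamma_C$ consists only of isolated vertices or loops, that is, there is no arrow in $\Gamma_C$ between distinct simple subcoalgebras. Likewise, in terms of comodules: if $S_1$ and $S_2$ are non-isomorphic simple left $C$-comodules, then there is no exact sequence $0\to S_1\to X\to S_2\to 0$ of left $C$-comodules with $X$ indecomposable; and the same holds for right $C$-comodules. -/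

import Mathlib

open scoped TensorProduct

universe u v w

/-! ## Comodules over a coalgebra -/

/-- A left comodule over a `k`-coalgebra `C`: a `k`-module `M` with a coassociative and counital
coaction `M → C ⊗ M`. -/
class LeftComodule (k C M : Type*) [Field k] [AddCommGroup C] [Module k C] [Coalgebra k C]
    [AddCommGroup M] [Module k M] where
  coact : M →ₗ[k] C ⊗[k] M
  coassoc : (TensorProduct.assoc k C C M).toLinearMap ∘ₗ
      (Coalgebra.comul (R := k) (A := C)).rTensor M ∘ₗ coact = coact.lTensor C ∘ₗ coact
  counit_coact : (Coalgebra.counit (R := k) (A := C)).rTensor M ∘ₗ coact =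
      TensorProduct.mk k k M 1

/-- A right comodule over a `k`-coalgebra `C`: a `k`-module `M` with a coassociative and counital
coaction `M → M ⊗ C`. -/
class RightComodule (k C M : Type*) [Field k] [AddCommGroup C] [Module k C] [Coalgebra k C]
    [AddCommGroup M] [Module k M] where
  coact : M →ₗ[k] M ⊗[k] C
  coassoc : (TensorProduct.assoc k M C C).toLinearMap ∘ₗ coact.rTensor C ∘ₗ coact =
      (Coalgebra.comul (R := k) (A := C)).lTensor M ∘ₗ coact
  counit_coact : (Coalgebra.counit (R := k) (A := C)).lTensor M ∘ₗ coact =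
      (TensorProduct.mk k M k).flip 1

namespace LeftComodule

variable (k C : Type*) [Field k] [AddCommGroup C] [Module k C] [Coalgebra k C]

/-- A coalgebra is a left comodule over itself. -/
instance self : LeftComodule k C C where
  coact := Coalgebra.comul
  coassoc := Coalgebra.coassoc
  counit_coact := Coalgebra.rTensor_counit_comp_comul

/-- `N` is a left subcomodule of `M`: the coaction maps `N` into `C ⊗ N`. -/
def IsSubcomodule {M : Type*} [AddCommGroup M] [Module k M] [LeftComodule k C M]
    (N : Submodule k M) : Prop :=
  N.map (coact : M →ₗ[k] C ⊗[k] M) ≤ LinearMap.range (N.subtype.lTensor C)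

/-- `M` is distributive: its lattice of subcomodules is distributive. -/
def IsDistributive (M : Type*) [AddCommGroup M] [Module k M] [LeftComodule k C M] : Prop :=
  ∀ N K L : Submodule k M, IsSubcomodule k C N → IsSubcomodule k C K → IsSubcomodule k C L →
    N ⊓ (K ⊔ L) = (N ⊓ K) ⊔ (N ⊓ L)

/-- `M` is simple: it is nonzero and its only subcomodules are `0` and `M`. -/
def IsSimple (M : Type*) [AddCommGroup M] [Module k M] [LeftComodule k C M] : Prop :=
  Nontrivial M ∧ ∀ N : Submodule k M, IsSubcomodule k C N → N = ⊥ ∨ N = ⊤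

/-- `M` is indecomposable: it is nonzero and not a direct sum of two nonzero subcomodules. -/
def IsIndecomposable (M : Type*) [AddCommGroup M] [Module k M] [LeftComodule k C M] : Prop :=
  Nontrivial M ∧ ∀ N K : Submodule k M, IsSubcomodule k C N → IsSubcomodule k C K →
    IsCompl N K → N = ⊥ ∨ K = ⊥

/-- `f` is a morphism of left `C`-comodules. -/
def IsColinear {M N : Type*} [AddCommGroup M] [Module k M] [LeftComodule k C M]
    [AddCommGroup N] [Module k N] [LeftComodule k C N] (f : M →ₗ[k] N) : Prop :=
  (coact : N →ₗ[k] C ⊗[k] N) ∘ₗ f = f.lTensor C ∘ₗ (coact : M →ₗ[k] C ⊗[k] M)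

/-- `M` and `N` are isomorphic as left `C`-comodules. -/
def Iso (M N : Type*) [AddCommGroup M] [Module k M] [LeftComodule k C M]
    [AddCommGroup N] [Module k N] [LeftComodule k C N] : Prop :=
  ∃ e : M ≃ₗ[k] N, IsColinear k C e.toLinearMap

/-- The arrow relation of the Ext quiver of left comodules: there is an exact sequence
`0 → S → X → T → 0` of left `C`-comodules with `X` indecomposable. -/
def HasArrow (S T : Type w) [AddCommGroup S] [Module k S] [LeftComodule k C S]
    [AddCommGroup T] [Module k T] [LeftComodule k C T] : Prop :=
  ∃ (X : Type w) (_ : AddCommGroup X) (_ : Module k X) (_ : LeftComodule k C X)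
    (f : S →ₗ[k] X) (g : X →ₗ[k] T),
    IsIndecomposable k C X ∧ IsColinear k C f ∧ IsColinear k C g ∧
      Function.Injective f ∧ Function.Exact f g ∧ Function.Surjective g

end LeftComodule

namespace RightComodule

variable (k C : Type*) [Field k] [AddCommGroup C] [Module k C] [Coalgebra k C]

/-- A coalgebra is a right comodule over itself. -/
instance self : RightComodule k C C where
  coact := Coalgebra.comul
  coassoc := Coalgebra.coassoc
  counit_coact := Coalgebra.lTensor_counit_comp_comul

/-- `N` is a right subcomodule of `M`: the coaction maps `N` into `N ⊗ C`. -/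
def IsSubcomodule {M : Type*} [AddCommGroup M] [Module k M] [RightComodule k C M]
    (N : Submodule k M) : Prop :=
  N.map (coact : M →ₗ[k] M ⊗[k] C) ≤ LinearMap.range (N.subtype.rTensor C)

/-- `M` is distributive: its lattice of subcomodules is distributive. -/
def IsDistributive (M : Type*) [AddCommGroup M] [Module k M] [RightComodule k C M] : Prop :=
  ∀ N K L : Submodule k M, IsSubcomodule k C N → IsSubcomodule k C K → IsSubcomodule k C L →
    N ⊓ (K ⊔ L) = (N ⊓ K) ⊔ (N ⊓ L)

/-- `M` is simple: it is nonzero and its only subcomodules are `0` and `M`. -/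
def IsSimple (M : Type*) [AddCommGroup M] [Module k M] [RightComodule k C M] : Prop :=
  Nontrivial M ∧ ∀ N : Submodule k M, IsSubcomodule k C N → N = ⊥ ∨ N = ⊤

/-- `M` is indecomposable: it is nonzero and not a direct sum of two nonzero subcomodules. -/
def IsIndecomposable (M : Type*) [AddCommGroup M] [Module k M] [RightComodule k C M] : Prop :=
  Nontrivial M ∧ ∀ N K : Submodule k M, IsSubcomodule k C N → IsSubcomodule k C K →
    IsCompl N K → N = ⊥ ∨ K = ⊥

/-- `f` is a morphism of right `C`-comodules. -/
def IsColinear {M N : Type*} [AddCommGroup M] [Module k M] [RightComodule k C M]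
    [AddCommGroup N] [Module k N] [RightComodule k C N] (f : M →ₗ[k] N) : Prop :=
  (coact : N →ₗ[k] N ⊗[k] C) ∘ₗ f = f.rTensor C ∘ₗ (coact : M →ₗ[k] M ⊗[k] C)

/-- `M` and `N` are isomorphic as right `C`-comodules. -/
def Iso (M N : Type*) [AddCommGroup M] [Module k M] [RightComodule k C M]
    [AddCommGroup N] [Module k N] [RightComodule k C N] : Prop :=
  ∃ e : M ≃ₗ[k] N, IsColinear k C e.toLinearMap

/-- The arrow relation of the Ext quiver of right comodules: there is an exact sequence
`0 → S → X → T → 0` of right `C`-comodules with `X` indecomposable. -/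
def HasArrow (S T : Type w) [AddCommGroup S] [Module k S] [RightComodule k C S]
    [AddCommGroup T] [Module k T] [RightComodule k C T] : Prop :=
  ∃ (X : Type w) (_ : AddCommGroup X) (_ : Module k X) (_ : RightComodule k C X)
    (f : S →ₗ[k] X) (g : X →ₗ[k] T),
    IsIndecomposable k C X ∧ IsColinear k C f ∧ IsColinear k C g ∧
      Function.Injective f ∧ Function.Exact f g ∧ Function.Surjective g

end RightComodule

/-! ## Distributive coalgebras and the quiver of a coalgebra -/

namespace Coalgebra

variable (k C : Type*) [Field k] [AddCommGroup C] [Module k C] [Coalgebra k C]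

/-- A coalgebra is distributive if it is distributive as a left or as a right comodule over
itself. -/
def IsDistributive : Prop :=
  LeftComodule.IsDistributive k C C ∨ RightComodule.IsDistributive k C C

variable {k C}

/-- `D` is a subcoalgebra: `Δ(D) ⊆ D ⊗ D`. -/
def IsSubcoalgebra (D : Submodule k C) : Prop :=
  D.map (comul : C →ₗ[k] C ⊗[k] C) ≤ LinearMap.range (_root_.TensorProduct.map D.subtype D.subtype)

/-- `D` is a simple subcoalgebra: a nonzero subcoalgebra whose only subcoalgebras are `0`
and `D`. -/
def IsSimpleSubcoalgebra (D : Submodule k C) : Prop :=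
  IsSubcoalgebra D ∧ D ≠ ⊥ ∧ ∀ E : Submodule k C, IsSubcoalgebra E → E ≤ D → E = ⊥ ∨ E = D

/-- The wedge `U ∧ V`, i.e. the kernel of `C → C ⊗ C → C/U ⊗ C/V`; equivalently the preimage of
`U ⊗ C + C ⊗ V` under the comultiplication. -/
def wedge (U V : Submodule k C) : Submodule k C :=
  LinearMap.ker (_root_.TensorProduct.map U.mkQ V.mkQ ∘ₗ (comul : C →ₗ[k] C ⊗[k] C))

variable (k C)

/-- The vertices of the quiver of `C`: the simple subcoalgebras of `C`. -/
def QuiverVertex : Type _ := {S : Submodule k C // IsSimpleSubcoalgebra S}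

/-- The quiver of `C`: there is one arrow from `S` to `T` if `T ∧ S ≠ S + T`, and none
otherwise. -/
instance quiver : Quiver (QuiverVertex k C) where
  Hom S T := PLift (wedge T.1 S.1 ≠ S.1 ⊔ T.1)

end Coalgebra

/-! If `φ` and `ψ` are homomorphisms of comodules whose images are independent in a distributive
comodule, then the graph of `(φ, ψ)` is a subcomodule of `im φ ⊕ im ψ`, and by distributivity it is
spanned by its intersections with the two summands. Hence the domain is `ker φ + ker ψ`.

The matrix coefficients of a comodule are homomorphisms to `C` that separate its points. Given a
nonsplit extension `X` of the simple comodules `S` and `T`, an embedding `φ : X → C` and the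
composite of `X → T` with an embedding `ψ : T → C` can therefore not have independent images, so
`im ψ` meets, hence equals, the socle `φ S` of `φ X`. If `C` is distributive on the other side, the
same argument applies to the transposed extension `T* → X* → S*`, because simple comodules are
finite dimensional.

For disjoint subcoalgebras `S` and `T`, a functional that vanishes on `S` and agrees with the counit
on `T` acts on `T ∧ S` as an idempotent homomorphism onto `T`. On its kernel `N` every coefficient
map given by a functional vanishing on `S` has its values in `T`, so its image is independent of
`N`, which forces it to vanish on `N`. Hence `N ⊆ S` and `T ∧ S = S + T`.
-/

/-- A family of linear operators on a module, indexed by `I`. A comodule is studied through the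
family of its contractions against the functionals on the coalgebra. -/
abbrev OperatorFamily (R I M : Type*) [Ring R] [AddCommGroup M] [Module R M] : Type _ :=
  I → Module.End R M

namespace OperatorFamily

section Lattice

variable {R I M N P : Type*} [Ring R] [AddCommGroup M] [Module R M] [AddCommGroup N] [Module R N]
  [AddCommGroup P] [Module R P]

/-- A submodule stable under every operator of the family. -/
def IsStable (a : OperatorFamily R I M) (K : Submodule R M) : Prop :=
  ∀ i, K ≤ K.comap (a i)

/-- The linear map `φ` commutes with the operators of two families with the same index set. -/
def Intertwines (a : OperatorFamily R I M) (b : OperatorFamily R I N) (φ : M →ₗ[R] N) : Prop :=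
  ∀ i x, φ (a i x) = b i (φ x)

/-- The lattice of stable submodules is distributive. -/
def IsDistributive (a : OperatorFamily R I M) : Prop :=
  ∀ K L Q : Submodule R M, a.IsStable K → a.IsStable L → a.IsStable Q →
    K ⊓ (L ⊔ Q) = (K ⊓ L) ⊔ (K ⊓ Q)

/-- The module is nonzero and its only stable submodules are `0` and itself. -/
def IsSimple (a : OperatorFamily R I M) : Prop :=
  Nontrivial M ∧ ∀ K : Submodule R M, a.IsStable K → K = ⊥ ∨ K = ⊤

/-- The module is not a direct sum of two nonzero stable submodules. The zero module is allowed. -/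
def IsIndecomposable (a : OperatorFamily R I M) : Prop :=
  ∀ K L : Submodule R M, a.IsStable K → a.IsStable L → IsCompl K L → K = ⊥ ∨ L = ⊥

/-- The intertwining maps from `a` to `b` separate the points of the domain. -/
def IsCogeneratedBy (a : OperatorFamily R I M) (b : OperatorFamily R I N) : Prop :=
  ∀ x ≠ 0, ∃ φ : M →ₗ[R] N, Intertwines a b φ ∧ φ x ≠ 0

/-- A short exact sequence `0 → M → N → P → 0` of intertwining maps. -/
structure IsShortExact (a : OperatorFamily R I M) (b : OperatorFamily R I N)
    (c : OperatorFamily R I P) (f : M →ₗ[R] N) (g : N →ₗ[R] P) : Prop where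
  intertwines_left : Intertwines a b f
  intertwines_right : Intertwines b c g
  injective : Function.Injective f
  exact : Function.Exact f g
  surjective : Function.Surjective g

variable {a : OperatorFamily R I M} {b : OperatorFamily R I N} {c : OperatorFamily R I P}

theorem isStable_top : a.IsStable ⊤ := fun _ _ _ => trivial

theorem IsStable.inf {K L : Submodule R M} (hK : a.IsStable K) (hL : a.IsStable L) :
    a.IsStable (K ⊓ L) :=
  fun i _ hx => ⟨hK i hx.1, hL i hx.2⟩

theorem IsStable.map {K : Submodule R M} (hK : a.IsStable K) {φ : M →ₗ[R] N}
    (hφ : Intertwines a b φ) : b.IsStable (K.map φ) := by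
  rintro i _ ⟨x, hx, rfl⟩
  exact ⟨a i x, hK i hx, hφ i x⟩

theorem IsStable.comap {K : Submodule R N} (hK : b.IsStable K) {φ : M →ₗ[R] N}
    (hφ : Intertwines a b φ) : a.IsStable (K.comap φ) := by
  intro i x hx
  simpa only [Submodule.mem_comap, hφ i x] using hK i hx

namespace Intertwines

theorem id : Intertwines a a LinearMap.id := fun _ _ => rfl

theorem add {φ ψ : M →ₗ[R] N} (hφ : Intertwines a b φ) (hψ : Intertwines a b ψ) :
    Intertwines a b (φ + ψ) :=
  fun i x => by simp only [LinearMap.add_apply, hφ i x, hψ i x, map_add]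

theorem comp {ψ : N →ₗ[R] P} {φ : M →ₗ[R] N} (hψ : Intertwines b c ψ) (hφ : Intertwines a b φ) :
    Intertwines a c (ψ ∘ₗ φ) :=
  fun i x => by simp only [LinearMap.comp_apply, hφ i x, hψ i (φ x)]

theorem isStable_ker {φ : M →ₗ[R] N} (hφ : Intertwines a b φ) : a.IsStable (LinearMap.ker φ) :=
  fun i x hx => by simp only [Submodule.mem_comap, LinearMap.mem_ker, hφ i x,
    LinearMap.mem_ker.1 hx, map_zero]

theorem isStable_range {φ : M →ₗ[R] N} (hφ : Intertwines a b φ) :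
    b.IsStable (LinearMap.range φ) :=
  LinearMap.range_eq_map φ ▸ isStable_top.map hφ

theorem exists_equiv_of_range_eq {φ : M →ₗ[R] P} {ψ : N →ₗ[R] P} (hφ : Intertwines a c φ)
    (hψ : Intertwines b c ψ) (hφ_inj : Function.Injective φ) (hψ_inj : Function.Injective ψ)
    (h : LinearMap.range φ = LinearMap.range ψ) :
    ∃ e : M ≃ₗ[R] N, Intertwines a b e.toLinearMap := by
  let e := LinearEquiv.ofInjective φ hφ_inj ≪≫ₗ LinearEquiv.ofEq _ _ h ≪≫ₗ
    (LinearEquiv.ofInjective ψ hψ_inj).symm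
  have he (x : M) : ψ (e x) = φ x :=
    congrArg Subtype.val (LinearEquiv.apply_symm_apply (LinearEquiv.ofInjective ψ hψ_inj) _)
  refine ⟨e, fun i x => hψ_inj ?_⟩
  simp only [LinearEquiv.coe_coe, he, hφ i x, hψ i (e x)]

end Intertwines

-- The graph `(φ + ψ) K` lies in `φ K ⊕ ψ K`, and distributivity splits it along the two summands.
theorem IsDistributive.le_ker_sup_ker (hb : b.IsDistributive) {φ ψ : M →ₗ[R] N}
    (hφ : Intertwines a b φ) (hψ : Intertwines a b ψ) {K : Submodule R M} (hK : a.IsStable K)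
    (hdisj : Disjoint (K.map φ) (K.map ψ)) :
    K ≤ LinearMap.ker φ ⊔ LinearMap.ker ψ := by
  intro x hx
  have hgraph : K.map (φ + ψ) ≤ K.map φ ⊔ K.map ψ := by
    rintro _ ⟨y, hy, rfl⟩
    exact Submodule.add_mem_sup (Submodule.mem_map_of_mem hy) (Submodule.mem_map_of_mem hy)
  have hsplit : (φ + ψ) x ∈ K.map (φ + ψ) ⊓ K.map φ ⊔ K.map (φ + ψ) ⊓ K.map ψ := by
    rw [← hb _ _ _ (hK.map (hφ.add hψ)) (hK.map hφ) (hK.map hψ), inf_eq_left.2 hgraph]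
    exact Submodule.mem_map_of_mem hx
  obtain ⟨_, ⟨⟨y, hy, rfl⟩, hyφ⟩, _, ⟨⟨z, hz, rfl⟩, hzψ⟩, hyz⟩ := Submodule.mem_sup.1 hsplit
  simp only [LinearMap.add_apply] at hyφ hzψ hyz
  have hmem {θ : M →ₗ[R] N} {w : M} (hw : w ∈ K) : θ w ∈ K.map θ := Submodule.mem_map_of_mem hw
  have hzero : ∀ v ∈ K.map φ, v ∈ K.map ψ → v = 0 := Submodule.disjoint_def.1 hdisj
  have hψy : ψ y = 0 := hzero _ ((Submodule.add_mem_iff_right _ (hmem hy)).1 hyφ) (hmem hy)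
  have hφz : φ z = 0 := hzero _ (hmem hz) ((Submodule.add_mem_iff_left _ (hmem hz)).1 hzψ)
  have hφxy : φ (x - y) = ψ (z - x) := by
    rw [map_sub, map_sub, sub_eq_sub_iff_add_eq_add, add_comm (ψ z), ← hyz, hψy, hφz, add_zero,
      zero_add]
  have hker : φ (x - y) = 0 :=
    hzero _ (hmem (sub_mem hx hy)) (hφxy ▸ hmem (sub_mem hz hx))
  exact Submodule.mem_sup.2 ⟨x - y, hker, y, hψy, sub_add_cancel x y⟩

theorem IsSimple.injective_of_ne_zero (ha : a.IsSimple) {φ : M →ₗ[R] N} (hφ : Intertwines a b φ)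
    (h0 : φ ≠ 0) : Function.Injective φ :=
  LinearMap.ker_eq_bot.1 ((ha.2 _ hφ.isStable_ker).resolve_right (h0 <| LinearMap.ker_eq_top.1 ·))

theorem IsSimple.range_le_or_disjoint (ha : a.IsSimple) {φ : M →ₗ[R] N} (hφ : Intertwines a b φ)
    {K : Submodule R N} (hK : b.IsStable K) :
    LinearMap.range φ ≤ K ∨ Disjoint (LinearMap.range φ) K := by
  refine (ha.2 _ (hK.comap hφ)).symm.imp LinearMap.range_le_iff_comap.2 fun h => ?_
  rw [disjoint_iff, ← Submodule.map_comap_eq, h, Submodule.map_bot]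

section Extension

variable {f : M →ₗ[R] N} {g : N →ₗ[R] P}

theorem IsShortExact.range_le (h : IsShortExact a b c f g) (ha : a.IsSimple) (hc : c.IsSimple)
    (hb : b.IsIndecomposable) {K : Submodule R N} (hK : b.IsStable K) (hK0 : K ≠ ⊥) :
    LinearMap.range f ≤ K := by
  have := ha.1
  refine (ha.range_le_or_disjoint h.intertwines_left hK).resolve_right fun hdisj => ?_
  rcases hc.2 _ (hK.map h.intertwines_right) with hgK | hgK
  · have hKf : K ≤ LinearMap.range f := by
      rwa [← h.exact.linearMap_ker_eq, LinearMap.le_ker_iff_map]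
    exact hK0 (hdisj.eq_bot_of_ge hKf)
  · have hcodisj : Codisjoint (LinearMap.range f) K := by
      rw [codisjoint_iff, sup_comm, ← h.exact.linearMap_ker_eq, ← Submodule.comap_map_eq, hgK,
        Submodule.comap_top]
    refine (hb _ _ h.intertwines_left.isStable_range hK ⟨hdisj, hcodisj⟩).elim (fun hf => ?_) hK0
    obtain ⟨x, hx⟩ := exists_ne (0 : M)
    exact hx (h.injective (by rw [LinearMap.range_eq_bot.1 hf, map_zero, LinearMap.zero_apply]))

variable {Q : Type*} [AddCommGroup Q] [Module R Q] {d : OperatorFamily R I Q}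

theorem IsShortExact.injective_of_comp_ne_zero (h : IsShortExact a b c f g) (ha : a.IsSimple)
    (hc : c.IsSimple) (hb : b.IsIndecomposable) {φ : N →ₗ[R] Q} (hφ : Intertwines b d φ)
    (hφf : φ ∘ₗ f ≠ 0) : Function.Injective φ := by
  by_contra hinj
  have hker : LinearMap.ker φ ≠ ⊥ := fun hker => hinj (LinearMap.ker_eq_bot.1 hker)
  exact hφf (LinearMap.range_le_ker_iff.1 (h.range_le ha hc hb hφ.isStable_ker hker))

theorem IsShortExact.not_disjoint_range (h : IsShortExact a b c f g) (hd : d.IsDistributive)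
    {φ : N →ₗ[R] Q} (hφ : Intertwines b d φ) (hφ_inj : Function.Injective φ) {ψ : P →ₗ[R] Q}
    (hψ : Intertwines c d ψ) (hψ0 : ψ ≠ 0) :
    ¬ Disjoint (LinearMap.range φ) (LinearMap.range ψ) := by
  intro hdisj
  have hgraph := hd.le_ker_sup_ker hφ (hψ.comp h.intertwines_right) isStable_top (by
    rwa [← LinearMap.range_eq_map, ← LinearMap.range_eq_map,
      LinearMap.range_comp_of_range_eq_top _ (LinearMap.range_eq_top.2 h.surjective)])
  rw [LinearMap.ker_eq_bot.2 hφ_inj, bot_sup_eq, top_le_iff, LinearMap.ker_eq_top] at hgraph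
  exact hψ0 (LinearMap.cancel_right h.surjective |>.1 (by rw [hgraph, LinearMap.zero_comp]))

theorem IsShortExact.exists_equiv (h : IsShortExact a b c f g) (ha : a.IsSimple) (hc : c.IsSimple)
    (hb : b.IsIndecomposable) (hd : d.IsDistributive) (hbd : b.IsCogeneratedBy d)
    (hcd : c.IsCogeneratedBy d) :
    ∃ e : M ≃ₗ[R] P, Intertwines a c e.toLinearMap := by
  have := ha.1
  have := hc.1
  obtain ⟨x, hx⟩ := exists_ne (0 : M)
  obtain ⟨φ, hφ, hφx⟩ := hbd (f x) ((map_ne_zero_iff f h.injective).2 hx)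
  have hφf : φ ∘ₗ f ≠ 0 := fun h0 => hφx (DFunLike.congr_fun h0 x)
  have hφ_inj := h.injective_of_comp_ne_zero ha hc hb hφ hφf
  obtain ⟨y, hy⟩ := exists_ne (0 : P)
  obtain ⟨ψ, hψ, hψy⟩ := hcd y hy
  have hψ0 : ψ ≠ 0 := fun h0 => hψy (by rw [h0, LinearMap.zero_apply])
  have hcomap : (LinearMap.range ψ).comap φ ≠ ⊥ := fun h0 => by
    refine h.not_disjoint_range hd hφ hφ_inj hψ hψ0 ?_
    rw [disjoint_iff, ← Submodule.map_comap_eq, h0, Submodule.map_bot]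
  have hle : LinearMap.range (φ ∘ₗ f) ≤ LinearMap.range ψ := by
    rw [LinearMap.range_comp, Submodule.map_le_iff_le_comap]
    exact h.range_le ha hc hb (hψ.isStable_range.comap hφ) hcomap
  have hφf_intertwines := hφ.comp h.intertwines_left
  have hge : LinearMap.range ψ ≤ LinearMap.range (φ ∘ₗ f) :=
    (hc.range_le_or_disjoint hψ hφf_intertwines.isStable_range).resolve_right fun hdisj =>
      hφf (LinearMap.range_eq_bot.1 (hdisj.symm.eq_bot_of_le hle))
  exact hφf_intertwines.exists_equiv_of_range_eq hψ (hφ_inj.comp h.injective)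
    (hc.injective_of_ne_zero hψ hψ0) (hle.antisymm hge)

end Extension

end Lattice

section Transpose

variable {R I M N : Type*} [CommRing R] [AddCommGroup M] [Module R M] [AddCommGroup N] [Module R N]

/-- The transposed operators on the dual space. -/
def transpose (a : OperatorFamily R I M) : OperatorFamily R I (Module.Dual R M) :=
  fun i => (a i).dualMap

variable {a : OperatorFamily R I M} {b : OperatorFamily R I N}

theorem Intertwines.dualMap {φ : M →ₗ[R] N} (hφ : Intertwines a b φ) :
    Intertwines b.transpose a.transpose φ.dualMap :=
  fun i η => LinearMap.ext fun x => congrArg η (hφ i x).symm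

theorem IsStable.dualCoannihilator {Φ : Submodule R (Module.Dual R M)}
    (hΦ : a.transpose.IsStable Φ) : a.IsStable Φ.dualCoannihilator := by
  intro i x hx
  rw [Submodule.mem_comap, Submodule.mem_dualCoannihilator]
  exact fun φ hφ => (Submodule.mem_dualCoannihilator x).1 hx _ (hΦ i hφ)

theorem exists_equiv_of_transpose [Module.IsReflexive R M] [Module.IsReflexive R N]
    {e : Module.Dual R N ≃ₗ[R] Module.Dual R M}
    (he : Intertwines b.transpose a.transpose e.toLinearMap) :
    ∃ e' : M ≃ₗ[R] N, Intertwines a b e'.toLinearMap := by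
  let e' : M ≃ₗ[R] N := Module.evalEquiv R M ≪≫ₗ e.dualMap ≪≫ₗ (Module.evalEquiv R N).symm
  have he' (η : Module.Dual R N) (x : M) : η (e' x) = e η x :=
    Module.apply_evalEquiv_symm_apply R N η _
  refine ⟨e', fun i x => (Module.evalEquiv R N).injective (LinearMap.ext fun η => ?_)⟩
  calc η (e' (a i x)) = e η (a i x) := he' η _
    _ = e (η ∘ₗ b i) x := (DFunLike.congr_fun (he i η) x).symm
    _ = η (b i (e' x)) := (he' (η ∘ₗ b i) x).symm

end Transpose

section FiniteDimensional

variable {k I M N P : Type*} [Field k] [AddCommGroup M] [Module k M] [AddCommGroup N] [Module k N]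
  [AddCommGroup P] [Module k P] {a : OperatorFamily k I M} {b : OperatorFamily k I N}
  {c : OperatorFamily k I P}

theorem IsSimple.transpose [FiniteDimensional k M] (ha : a.IsSimple) : a.transpose.IsSimple := by
  have := ha.1
  refine ⟨inferInstance, fun Φ hΦ => ?_⟩
  rw [← Subspace.dualCoannihilator_dualAnnihilator_eq (W := Φ)]
  rcases ha.2 _ hΦ.dualCoannihilator with h | h
  · exact .inr (by rw [h, Submodule.dualAnnihilator_bot])
  · exact .inl (by rw [h, Submodule.dualAnnihilator_top])

theorem IsIndecomposable.transpose [FiniteDimensional k M] (ha : a.IsIndecomposable) :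
    a.transpose.IsIndecomposable := by
  intro Φ Ψ hΦ hΨ hcompl
  have htop {Θ : Submodule k (Module.Dual k M)} (h : Θ.dualCoannihilator = ⊥) : Θ = ⊤ := by
    rw [← Subspace.dualCoannihilator_dualAnnihilator_eq (W := Θ), h,
      Submodule.dualAnnihilator_bot]
  have hcompl' : IsCompl Φ.dualCoannihilator Ψ.dualCoannihilator :=
    (Subspace.orderIsoFiniteDimensional (K := k) (V := M)).symm.isCompl hcompl.dual
  rcases ha _ _ hΦ.dualCoannihilator hΨ.dualCoannihilator hcompl' with h | h
  · exact .inr (eq_bot_of_top_isCompl (htop h ▸ hcompl))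
  · exact .inl (eq_bot_of_isCompl_top (htop h ▸ hcompl))

theorem IsShortExact.transpose {f : M →ₗ[k] N} {g : N →ₗ[k] P} (h : IsShortExact a b c f g) :
    IsShortExact c.transpose b.transpose a.transpose g.dualMap f.dualMap where
  intertwines_left := h.intertwines_right.dualMap
  intertwines_right := h.intertwines_left.dualMap
  injective := LinearMap.dualMap_injective_of_surjective h.surjective
  exact := LinearMap.exact_iff.2 (by
    rw [LinearMap.ker_dualMap_eq_dualAnnihilator_range,
      LinearMap.range_dualMap_eq_dualAnnihilator_ker, h.exact.linearMap_ker_eq])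
  surjective := LinearMap.dualMap_surjective_of_injective h.injective

theorem IsShortExact.exists_equiv_of_transpose {Q : Type*} [AddCommGroup Q] [Module k Q]
    {d : OperatorFamily k I Q} [FiniteDimensional k M] [FiniteDimensional k P]
    {f : M →ₗ[k] N} {g : N →ₗ[k] P}
    (h : IsShortExact a b c f g) (ha : a.IsSimple) (hc : c.IsSimple)
    (hb : b.IsIndecomposable) (hd : d.IsDistributive) (hbd : b.transpose.IsCogeneratedBy d)
    (had : a.transpose.IsCogeneratedBy d) :
    ∃ e : M ≃ₗ[k] P, Intertwines a c e.toLinearMap := by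
  have : FiniteDimensional k N := .of_exact h.exact h.surjective
  obtain ⟨e, he⟩ :=
    h.transpose.exists_equiv hc.transpose ha.transpose hb.transpose hd hbd had
  exact OperatorFamily.exists_equiv_of_transpose he

end FiniteDimensional

end OperatorFamily

section Contraction

variable {R V V' W W' X : Type*} [CommRing R] [AddCommGroup V] [Module R V] [AddCommGroup V']
  [Module R V'] [AddCommGroup W] [Module R W] [AddCommGroup W'] [Module R W'] [AddCommGroup X]
  [Module R X]

/-- Contraction of the first tensor factor against a functional. -/
def contractFst : Module.Dual R V →ₗ[R] V ⊗[R] W →ₗ[R] W :=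
  LinearMap.compRight R (TensorProduct.lid R W).toLinearMap ∘ₗ LinearMap.rTensorHom W

/-- Contraction of the second tensor factor against a functional. -/
def contractSnd : Module.Dual R W →ₗ[R] V ⊗[R] W →ₗ[R] V :=
  LinearMap.compRight R (TensorProduct.rid R V).toLinearMap ∘ₗ LinearMap.lTensorHom V

@[simp]
theorem contractFst_tmul (f : Module.Dual R V) (v : V) (w : W) :
    contractFst f (v ⊗ₜ w) = f v • w := rfl

@[simp]
theorem contractSnd_tmul (g : Module.Dual R W) (v : V) (w : W) :
    contractSnd g (v ⊗ₜ w) = g w • v := rfl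

theorem apply_contractFst (f : Module.Dual R V) (g : Module.Dual R W) (z : V ⊗[R] W) :
    g (contractFst f z) = f (contractSnd g z) := by
  induction z with
  | zero => simp only [map_zero]
  | add y z hy hz => simp only [map_add, hy, hz]
  | tmul v w => simp [mul_comm]

theorem contractFst_comm (g : Module.Dual R W) (z : V ⊗[R] W) :
    contractFst g (TensorProduct.comm R V W z) = contractSnd g z := by
  induction z with
  | zero => simp only [map_zero]
  | add y z hy hz => simp only [map_add, hy, hz]
  | tmul v w => rfl

theorem contractSnd_comm (f : Module.Dual R V) (z : V ⊗[R] W) :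
    contractSnd f (TensorProduct.comm R V W z) = contractFst f z := by
  rw [← contractFst_comm, TensorProduct.comm_comm]

theorem contractFst_lTensor (f : Module.Dual R V) (φ : W →ₗ[R] W') (z : V ⊗[R] W) :
    contractFst f (φ.lTensor V z) = φ (contractFst f z) := by
  induction z with
  | zero => simp only [map_zero]
  | add y z hy hz => simp only [map_add, hy, hz]
  | tmul v w => simp

theorem contractSnd_lTensor (g : Module.Dual R W') (φ : W →ₗ[R] W') (z : V ⊗[R] W) :
    contractSnd g (φ.lTensor V z) = contractSnd (g ∘ₗ φ) z := by
  induction z with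
  | zero => simp only [map_zero]
  | add y z hy hz => simp only [map_add, hy, hz]
  | tmul v w => simp

theorem contractSnd_rTensor (g : Module.Dual R W) (φ : V →ₗ[R] V') (z : V ⊗[R] W) :
    contractSnd g (φ.rTensor W z) = φ (contractSnd g z) := by
  induction z with
  | zero => simp only [map_zero]
  | add y z hy hz => simp only [map_add, hy, hz]
  | tmul v w => simp

theorem contractSnd_contractFst_assoc (f : Module.Dual R V) (h : Module.Dual R X)
    (t : (V ⊗[R] W) ⊗[R] X) :
    contractSnd h (contractFst f (TensorProduct.assoc R V W X t)) =
      contractFst f (contractSnd h t) := by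
  suffices (contractSnd h ∘ₗ contractFst f) ∘ₗ (TensorProduct.assoc R V W X).toLinearMap =
      contractFst f ∘ₗ contractSnd h from DFunLike.congr_fun this t
  ext v w x
  simp [smul_smul, mul_comm]

theorem contractSnd_comp_contractFst_assoc (g : Module.Dual R W) (h : Module.Dual R X)
    (t : (V ⊗[R] W) ⊗[R] X) :
    contractSnd (h ∘ₗ contractFst g) (TensorProduct.assoc R V W X t) =
      contractSnd g (contractSnd h t) := by
  suffices contractSnd (h ∘ₗ contractFst g) ∘ₗ (TensorProduct.assoc R V W X).toLinearMap =
      contractSnd g ∘ₗ contractSnd h from DFunLike.congr_fun this t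
  ext v w x
  simp [smul_smul, mul_comm]

theorem eq_zero_of_forall_contractFst [Module.Free R V] {z : V ⊗[R] W}
    (h : ∀ f : Module.Dual R V, contractFst f z = 0) : z = 0 := by
  let b := Module.Free.chooseBasis R V
  refine (TensorProduct.equivFinsuppOfBasisLeft b).map_eq_zero_iff.1 (Finsupp.ext fun i => ?_)
  exact (TensorProduct.equivFinsuppOfBasisLeft_apply b z i).trans (h (b.coord i))

theorem mem_range_lTensor_subtype_iff [Module.Free R V] {U : Submodule R W} {z : V ⊗[R] W} :
    z ∈ LinearMap.range (U.subtype.lTensor V) ↔ ∀ f : Module.Dual R V, contractFst f z ∈ U := by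
  rw [← (lTensor_exact V (LinearMap.exact_subtype_mkQ U) U.mkQ_surjective).linearMap_ker_eq,
    LinearMap.mem_ker]
  have hmk (f : Module.Dual R V) :
      contractFst f (U.mkQ.lTensor V z) = 0 ↔ contractFst f z ∈ U := by
    rw [contractFst_lTensor, Submodule.mkQ_apply, Submodule.Quotient.mk_eq_zero]
  exact ⟨fun hz f => (hmk f).1 (by rw [hz, map_zero]),
    fun h => eq_zero_of_forall_contractFst fun f => (hmk f).2 (h f)⟩

theorem mem_range_rTensor_subtype_iff [Module.Free R W] {U : Submodule R V} {z : V ⊗[R] W} :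
    z ∈ LinearMap.range (U.subtype.rTensor W) ↔ ∀ g : Module.Dual R W, contractSnd g z ∈ U := by
  simp only [← contractFst_comm, ← mem_range_lTensor_subtype_iff]
  constructor
  · rintro ⟨y, rfl⟩
    exact ⟨TensorProduct.comm R U W y, LinearMap.lTensor_comm _ _⟩
  · rintro ⟨y, hy⟩
    refine ⟨TensorProduct.comm R W U y, ?_⟩
    rw [LinearMap.rTensor_comm, hy, TensorProduct.comm_comm]

theorem contractSnd_mem_of_map_mkQ_eq_zero {T : Submodule R V} {U : Submodule R W}
    {z : V ⊗[R] W} (hz : TensorProduct.map T.mkQ U.mkQ z = 0) {g : Module.Dual R W}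
    (hg : g ∈ U.dualAnnihilator) :
    contractSnd g z ∈ T := by
  obtain ⟨g, rfl⟩ : ∃ g' : Module.Dual R (W ⧸ U), g' ∘ₗ U.mkQ = g :=
    ⟨U.liftQ g fun x hx => (Submodule.mem_dualAnnihilator g).1 hg x hx, Submodule.liftQ_mkQ _ _ _⟩
  have hz' : T.mkQ.rTensor _ (U.mkQ.lTensor V z) = 0 :=
    (DFunLike.congr_fun (LinearMap.rTensor_comp_lTensor _ _ _) z).trans hz
  rw [← Submodule.Quotient.mk_eq_zero T, ← Submodule.mkQ_apply, ← contractSnd_lTensor,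
    ← contractSnd_rTensor, hz', map_zero]

theorem contractFst_mem_of_map_mkQ_eq_zero {T : Submodule R V} {U : Submodule R W}
    {z : V ⊗[R] W} (hz : TensorProduct.map T.mkQ U.mkQ z = 0) {f : Module.Dual R V}
    (hf : f ∈ T.dualAnnihilator) :
    contractFst f z ∈ U := by
  rw [← contractSnd_comm]
  refine contractSnd_mem_of_map_mkQ_eq_zero ?_ hf
  rw [TensorProduct.map_comm, hz, map_zero]

theorem assoc_rTensor_comm_comm_assoc (t : (V ⊗[R] W) ⊗[R] X) :
    TensorProduct.assoc R X W V ((TensorProduct.comm R W X).toLinearMap.rTensor V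
        (TensorProduct.comm R V (W ⊗[R] X) (TensorProduct.assoc R V W X t))) =
      (TensorProduct.comm R V W).toLinearMap.lTensor X (TensorProduct.comm R (V ⊗[R] W) X t) := by
  suffices (TensorProduct.assoc R X W V).toLinearMap ∘ₗ
        (TensorProduct.comm R W X).toLinearMap.rTensor V ∘ₗ
        (TensorProduct.comm R V (W ⊗[R] X)).toLinearMap ∘ₗ
        (TensorProduct.assoc R V W X).toLinearMap =
      (TensorProduct.comm R V W).toLinearMap.lTensor X ∘ₗ
        (TensorProduct.comm R (V ⊗[R] W) X).toLinearMap from DFunLike.congr_fun this t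
  ext v w x
  rfl

end Contraction

theorem mem_range_map_subtype_iff {k V W : Type*} [Field k] [AddCommGroup V] [Module k V]
    [AddCommGroup W] [Module k W] {T : Submodule k V} {U : Submodule k W} {z : V ⊗[k] W} :
    z ∈ LinearMap.range (TensorProduct.map T.subtype U.subtype) ↔
      (∀ f : Module.Dual k V, contractFst f z ∈ U) ∧
        ∀ g : Module.Dual k W, contractSnd g z ∈ T := by
  rw [← mem_range_lTensor_subtype_iff, ← mem_range_rTensor_subtype_iff]
  constructor
  · intro hz
    have hz' := hz
    rw [← LinearMap.rTensor_comp_lTensor] at hz'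
    rw [← LinearMap.lTensor_comp_rTensor] at hz
    exact ⟨LinearMap.range_comp_le_range _ _ hz, LinearMap.range_comp_le_range _ _ hz'⟩
  · rintro ⟨⟨y, rfl⟩, hy⟩
    rw [mem_range_rTensor_subtype_iff] at hy
    have hyT : y ∈ LinearMap.range (T.subtype.rTensor U) := by
      refine mem_range_rTensor_subtype_iff.2 fun g => ?_
      obtain ⟨g', rfl⟩ := LinearMap.exists_extend g
      rw [← contractSnd_lTensor]
      exact hy g'
    obtain ⟨x, rfl⟩ := hyT
    exact ⟨x, by rw [← LinearMap.lTensor_comp_rTensor, LinearMap.comp_apply]⟩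

section Coaction

variable {R C M N : Type*} [CommRing R] [AddCommGroup C] [Module R C] [AddCommGroup M] [Module R M]
  [AddCommGroup N] [Module R N]

/-- `δ` is a left coaction of the comultiplication `Δ` with counit `ε`. The structure maps are
unbundled, so that right comodules are covered by composing `Δ` and the coaction with the swap of
the tensor factors. -/
structure IsCoaction (Δ : C →ₗ[R] C ⊗[R] C) (ε : Module.Dual R C) (δ : M →ₗ[R] C ⊗[R] M) :
    Prop where
  coassoc : ∀ m, TensorProduct.assoc R C C M (Δ.rTensor M (δ m)) = δ.lTensor C (δ m)
  counit : ∀ m, contractFst ε (δ m) = m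

/-- The action of the dual space of `C` on a left comodule: `f` acts by `m ↦ ∑ f(m₋₁) m₀`. -/
def dualAction (δ : M →ₗ[R] C ⊗[R] M) : OperatorFamily R (Module.Dual R C) M :=
  fun f => contractFst f ∘ₗ δ

/-- The matrix coefficients `m ↦ ∑ ξ(m₀) m₋₁` of a left comodule. -/
def coefficient (δ : M →ₗ[R] C ⊗[R] M) (ξ : Module.Dual R M) : M →ₗ[R] C :=
  contractSnd ξ ∘ₗ δ

variable {Δ : C →ₗ[R] C ⊗[R] C} {ε : Module.Dual R C} {δ : M →ₗ[R] C ⊗[R] M}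

theorem apply_dualAction (δ : M →ₗ[R] C ⊗[R] M) (f : Module.Dual R C) (ξ : Module.Dual R M)
    (m : M) : ξ (dualAction δ f m) = f (coefficient δ ξ m) :=
  apply_contractFst f ξ (δ m)

theorem dualAction_comm_comp (Δ : C →ₗ[R] C ⊗[R] C) :
    dualAction ((TensorProduct.comm R C C).toLinearMap ∘ₗ Δ) = coefficient Δ :=
  funext fun f => LinearMap.ext fun x => contractFst_comm f (Δ x)

theorem coefficient_comm_comp (Δ : C →ₗ[R] C ⊗[R] C) :
    coefficient ((TensorProduct.comm R C C).toLinearMap ∘ₗ Δ) = dualAction Δ :=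
  funext fun f => LinearMap.ext fun x => contractSnd_comm f (Δ x)

theorem isStable_dualAction_iff [Module.Free R C] {K : Submodule R M} :
    (dualAction δ).IsStable K ↔ K.map δ ≤ LinearMap.range (K.subtype.lTensor C) := by
  rw [Submodule.map_le_iff_le_comap]
  simp only [SetLike.le_def, Submodule.mem_comap, mem_range_lTensor_subtype_iff]
  exact ⟨fun h _ hm f => h f hm, fun h f _ hm => h hm f⟩

theorem intertwines_dualAction_iff [Module.Free R C] {δ' : N →ₗ[R] C ⊗[R] N} {φ : M →ₗ[R] N} :
    OperatorFamily.Intertwines (dualAction δ) (dualAction δ') φ ↔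
      δ' ∘ₗ φ = φ.lTensor C ∘ₗ δ := by
  have hφ (f : Module.Dual R C) (m : M) :
      φ (dualAction δ f m) = contractFst f (φ.lTensor C (δ m)) :=
    (contractFst_lTensor f φ (δ m)).symm
  refine ⟨fun h => LinearMap.ext fun m => sub_eq_zero.1 (eq_zero_of_forall_contractFst fun f => ?_),
    fun h f m => ?_⟩
  · rw [map_sub, sub_eq_zero]
    exact (h f m).symm.trans (hφ f m)
  · rw [hφ]
    exact congrArg (contractFst f) (DFunLike.congr_fun h m).symm

namespace IsCoaction

theorem counit_coefficient (hδ : IsCoaction Δ ε δ) (ξ : Module.Dual R M) (m : M) :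
    ε (coefficient δ ξ m) = ξ m := by
  rw [← apply_dualAction]
  exact congrArg ξ (hδ.counit m)

theorem intertwines_coefficient (hδ : IsCoaction Δ ε δ) (ξ : Module.Dual R M) :
    OperatorFamily.Intertwines (dualAction δ) (dualAction Δ) (coefficient δ ξ) := by
  intro f m
  calc contractSnd ξ (δ (contractFst f (δ m)))
      = contractSnd ξ (contractFst f (TensorProduct.assoc R C C M (Δ.rTensor M (δ m)))) := by
        rw [hδ.coassoc, contractFst_lTensor]
    _ = contractFst f (Δ (contractSnd ξ (δ m))) := by
        rw [contractSnd_contractFst_assoc, contractSnd_rTensor]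

theorem coefficient_comp_dualAction (hδ : IsCoaction Δ ε δ) (f : Module.Dual R C)
    (ξ : Module.Dual R M) (m : M) :
    coefficient δ (ξ ∘ₗ dualAction δ f) m = coefficient Δ f (coefficient δ ξ m) := by
  calc contractSnd ((ξ ∘ₗ contractFst f) ∘ₗ δ) (δ m)
      = contractSnd (ξ ∘ₗ contractFst f) (TensorProduct.assoc R C C M (Δ.rTensor M (δ m))) := by
        rw [hδ.coassoc, contractSnd_lTensor]
    _ = contractSnd f (Δ (contractSnd ξ (δ m))) := by
        rw [contractSnd_comp_contractFst_assoc, contractSnd_rTensor]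

theorem intertwines_transpose (hδ : IsCoaction Δ ε δ) (m : M) :
    OperatorFamily.Intertwines (dualAction δ).transpose (coefficient Δ)
      (contractSnd.flip (δ m)) :=
  fun f ξ => hδ.coefficient_comp_dualAction f ξ m

theorem dualAction_dualAction [Module.Projective R M] (hδ : IsCoaction Δ ε δ)
    (f g : Module.Dual R C) (m : M) :
    dualAction δ g (dualAction δ f m) = dualAction δ (f ∘ₗ coefficient Δ g) m := by
  refine Module.eval_apply_injective R (LinearMap.ext fun ξ => ?_)
  calc ξ (dualAction δ g (dualAction δ f m))
      = f (coefficient δ (ξ ∘ₗ dualAction δ g) m) := apply_dualAction δ f (ξ ∘ₗ dualAction δ g) m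
    _ = f (coefficient Δ g (coefficient δ ξ m)) := by rw [hδ.coefficient_comp_dualAction]
    _ = ξ (dualAction δ (f ∘ₗ coefficient Δ g) m) :=
        (apply_dualAction δ (f ∘ₗ coefficient Δ g) ξ m).symm

theorem isCogeneratedBy [Module.Projective R M] (hδ : IsCoaction Δ ε δ) :
    (dualAction δ).IsCogeneratedBy (dualAction Δ) := by
  intro m hm
  obtain ⟨ξ, hξ⟩ := Module.Projective.exists_dual_ne_zero R hm
  refine ⟨coefficient δ ξ, hδ.intertwines_coefficient ξ, fun h => hξ ?_⟩
  rw [← hδ.counit_coefficient, h, map_zero]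

theorem transpose_isCogeneratedBy (hδ : IsCoaction Δ ε δ) :
    (dualAction δ).transpose.IsCogeneratedBy (coefficient Δ) := by
  intro ξ hξ
  obtain ⟨m, hm⟩ := DFunLike.ne_iff.1 hξ
  refine ⟨contractSnd.flip (δ m), hδ.intertwines_transpose m, fun h => hm ?_⟩
  have hcoeff : coefficient δ ξ m = 0 := h
  rw [← hδ.counit_coefficient, hcoeff, map_zero, LinearMap.zero_apply]

end IsCoaction

end Coaction

namespace IsCoaction

variable {k C M N P : Type*} [Field k] [AddCommGroup C] [Module k C] [AddCommGroup M] [Module k M]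
  [AddCommGroup N] [Module k N] [AddCommGroup P] [Module k P] {Δ : C →ₗ[k] C ⊗[k] C}
  {ε : Module.Dual k C}

theorem finiteDimensional_of_isSimple {δ : M →ₗ[k] C ⊗[k] M} (hδ : IsCoaction Δ ε δ)
    (h : (dualAction δ).IsSimple) :
    FiniteDimensional k M := by
  have := h.1
  obtain ⟨m, hm⟩ := exists_ne (0 : M)
  let orbit : Submodule k M := LinearMap.range (contractFst.flip (δ m))
  have horbit : (dualAction δ).IsStable orbit := by
    rintro g _ ⟨f, rfl⟩
    exact ⟨f ∘ₗ coefficient Δ g, (hδ.dualAction_dualAction f g m).symm⟩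
  have hm_orbit : m ∈ orbit := ⟨ε, hδ.counit m⟩
  have htop : orbit = ⊤ := (h.2 orbit horbit).resolve_left fun hbot =>
    hm ((Submodule.eq_bot_iff _).1 hbot m hm_orbit)
  obtain ⟨V, hV, hδV⟩ :=
    TensorProduct.exists_finite_submodule_right_of_setFinite {δ m} (Set.finite_singleton _)
  have hVtop : V = ⊤ := by
    rw [eq_top_iff, ← htop]
    rintro _ ⟨f, rfl⟩
    exact mem_range_lTensor_subtype_iff.1 (hδV rfl) f
  exact Module.finite_def.2 (hVtop ▸ Module.Finite.iff_fg.1 hV)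

theorem exists_equiv {δM : M →ₗ[k] C ⊗[k] M} {δN : N →ₗ[k] C ⊗[k] N}
    {δP : P →ₗ[k] C ⊗[k] P} (hM : IsCoaction Δ ε δM) (hN : IsCoaction Δ ε δN)
    (hP : IsCoaction Δ ε δP)
    (hΔ : (dualAction Δ).IsDistributive ∨ OperatorFamily.IsDistributive (coefficient Δ))
    (hM_simple : (dualAction δM).IsSimple) (hP_simple : (dualAction δP).IsSimple)
    (hN_indec : (dualAction δN).IsIndecomposable) {f : M →ₗ[k] N} {g : N →ₗ[k] P}
    (h : OperatorFamily.IsShortExact (dualAction δM) (dualAction δN) (dualAction δP) f g) :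
    ∃ e : M ≃ₗ[k] P, OperatorFamily.Intertwines (dualAction δM) (dualAction δP) e.toLinearMap := by
  rcases hΔ with hΔ | hΔ
  · exact h.exists_equiv hM_simple hP_simple hN_indec hΔ hN.isCogeneratedBy hP.isCogeneratedBy
  · have := hM.finiteDimensional_of_isSimple hM_simple
    have := hP.finiteDimensional_of_isSimple hP_simple
    exact h.exists_equiv_of_transpose hM_simple hP_simple hN_indec hΔ hN.transpose_isCogeneratedBy
      hM.transpose_isCogeneratedBy

end IsCoaction

section Wedge

variable {k C : Type*} [Field k] [AddCommGroup C] [Module k C] {Δ : C →ₗ[k] C ⊗[k] C}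
  {ε : Module.Dual k C} {S T : Submodule k C}

theorem exists_mem_dualAnnihilator_eqOn {V : Type*} [AddCommGroup V] [Module k V]
    {S T : Submodule k V} (hST : Disjoint S T) (ε : Module.Dual k V) :
    ∃ ξ ∈ S.dualAnnihilator, Set.EqOn ξ ε T := by
  obtain ⟨ξ, hξ, ζ, hζ, hsum⟩ : ∃ ξ ∈ S.dualAnnihilator, ∃ ζ ∈ T.dualAnnihilator, ξ + ζ = ε := by
    rw [← Submodule.mem_sup, ← Subspace.dualAnnihilator_inf_eq, hST.eq_bot,
      Submodule.dualAnnihilator_bot]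
    trivial
  refine ⟨ξ, hξ, fun t ht => ?_⟩
  rw [← hsum, LinearMap.add_apply, (Submodule.mem_dualAnnihilator ζ).1 hζ t ht, add_zero]

theorem coefficient_eq_self_of_eqOn (hT : (dualAction Δ).IsStable T)
    (hε : ∀ x, coefficient Δ ε x = x) {ξ : Module.Dual k C} (hξ : Set.EqOn ξ ε T) {x : C}
    (hx : x ∈ T) : coefficient Δ ξ x = x := by
  refine Module.eval_apply_injective k (LinearMap.ext fun f => ?_)
  calc f (coefficient Δ ξ x) = ξ (dualAction Δ f x) := (apply_dualAction Δ f ξ x).symm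
    _ = ε (dualAction Δ f x) := hξ (hT f hx)
    _ = f x := by rw [apply_dualAction, hε]

namespace IsCoaction

theorem le_of_map_coefficient_le (hΔ : IsCoaction Δ ε Δ) (hdist : (dualAction Δ).IsDistributive)
    {N : Submodule k C} (hN : (dualAction Δ).IsStable N) (hNT : Disjoint N T)
    (h : ∀ g ∈ S.dualAnnihilator, N.map (coefficient Δ g) ≤ T) : N ≤ S := by
  intro y hy
  refine (Subspace.forall_mem_dualAnnihilator_apply_eq_zero_iff S y).1 fun g hg => ?_
  have hker := hdist.le_ker_sup_ker .id (hΔ.intertwines_coefficient g) hN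
    ((N.map_id.symm ▸ hNT).mono_right (h g hg))
  rw [LinearMap.ker_id, bot_sup_eq] at hker
  rw [← hΔ.counit_coefficient, hker hy, map_zero]

theorem mem_sup_of_forall_coefficient_mem (hΔ : IsCoaction Δ ε Δ)
    (hε : ∀ x, coefficient Δ ε x = x) (hdist : (dualAction Δ).IsDistributive)
    (hT : (dualAction Δ).IsStable T) (hT' : OperatorFamily.IsStable (coefficient Δ) T)
    (hST : Disjoint S T) {x : C} (hx : ∀ g ∈ S.dualAnnihilator, coefficient Δ g x ∈ T) :
    x ∈ S ⊔ T := by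
  obtain ⟨ξ, hξS, hξT⟩ := exists_mem_dualAnnihilator_eqOn hST ε
  have hretract {t : C} (ht : t ∈ T) : coefficient Δ ξ t = t :=
    coefficient_eq_self_of_eqOn hT hε hξT ht
  let W : Submodule k C := ⨅ g ∈ S.dualAnnihilator, T.comap (coefficient Δ g)
  have hW {y : C} : y ∈ W ↔ ∀ g ∈ S.dualAnnihilator, coefficient Δ g y ∈ T := by
    simp only [W, Submodule.mem_iInf, Submodule.mem_comap]
  have hW_stable : (dualAction Δ).IsStable W := fun f y hy => hW.2 fun g hg =>
    hT.comap (hΔ.intertwines_coefficient g) f (hW.1 hy g hg)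
  let N := W ⊓ LinearMap.ker (coefficient Δ ξ)
  have hN : (dualAction Δ).IsStable N := hW_stable.inf (hΔ.intertwines_coefficient ξ).isStable_ker
  have hNT : Disjoint N T :=
    Submodule.disjoint_def.2 fun y hy hyT => (hretract hyT).symm.trans (LinearMap.mem_ker.1 hy.2)
  have hNS : N ≤ S := hΔ.le_of_map_coefficient_le hdist hN hNT fun g hg =>
    Submodule.map_le_iff_le_comap.2 fun y hy => hW.1 hy.1 g hg
  have hxT : coefficient Δ ξ x ∈ T := hx ξ hξS
  have hxN : x - coefficient Δ ξ x ∈ N :=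
    ⟨sub_mem (hW.2 hx) (hW.2 fun g _ => hT' g hxT),
      LinearMap.mem_ker.2 (by rw [map_sub, hretract hxT, sub_self])⟩
  exact Submodule.mem_sup.2 ⟨_, hNS hxN, _, hxT, sub_add_cancel _ _⟩

end IsCoaction

end Wedge

namespace LeftComodule

variable {k C M N : Type*} [Field k] [AddCommGroup C] [Module k C] [Coalgebra k C]
  [AddCommGroup M] [Module k M] [LeftComodule k C M] [AddCommGroup N] [Module k N]
  [LeftComodule k C N]

theorem isCoaction :
    IsCoaction Coalgebra.comul Coalgebra.counit (coact : M →ₗ[k] C ⊗[k] M) where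
  coassoc := DFunLike.congr_fun coassoc
  counit m := (congrArg (TensorProduct.lid k M) (DFunLike.congr_fun counit_coact m)).trans
    (one_smul k m)

theorem isSubcomodule_iff {K : Submodule k M} :
    IsSubcomodule k C K ↔ (dualAction (coact : M →ₗ[k] C ⊗[k] M)).IsStable K :=
  isStable_dualAction_iff.symm

theorem isDistributive_iff :
    IsDistributive k C M ↔ (dualAction (coact : M →ₗ[k] C ⊗[k] M)).IsDistributive := by
  simp only [IsDistributive, OperatorFamily.IsDistributive, isSubcomodule_iff]

theorem isSimple_iff : IsSimple k C M ↔ (dualAction (coact : M →ₗ[k] C ⊗[k] M)).IsSimple := by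
  simp only [IsSimple, OperatorFamily.IsSimple, isSubcomodule_iff]

theorem isIndecomposable_iff : IsIndecomposable k C M ↔
    Nontrivial M ∧ (dualAction (coact : M →ₗ[k] C ⊗[k] M)).IsIndecomposable := by
  simp only [IsIndecomposable, OperatorFamily.IsIndecomposable, isSubcomodule_iff]

theorem isColinear_iff {φ : M →ₗ[k] N} : IsColinear k C φ ↔
    OperatorFamily.Intertwines (dualAction (coact : M →ₗ[k] C ⊗[k] M))
      (dualAction (coact : N →ₗ[k] C ⊗[k] N)) φ :=
  intertwines_dualAction_iff.symm

end LeftComodule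

namespace RightComodule

variable {k C M N : Type*} [Field k] [AddCommGroup C] [Module k C] [Coalgebra k C]
  [AddCommGroup M] [Module k M] [RightComodule k C M] [AddCommGroup N] [Module k N]
  [RightComodule k C N]

variable (k C M) in
/-- The coaction of a right comodule with its tensor factors swapped, which is a left coaction of
the opposite coalgebra. -/
def opCoact : M →ₗ[k] C ⊗[k] M :=
  (TensorProduct.comm k M C).toLinearMap ∘ₗ coact

theorem isCoaction :
    IsCoaction ((TensorProduct.comm k C C).toLinearMap ∘ₗ Coalgebra.comul) Coalgebra.counit
      (opCoact k C M) where
  coassoc m := by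
    have hcoassoc : TensorProduct.assoc k M C C (coact.rTensor C (coact (C := C) m)) =
        Coalgebra.comul.lTensor M (coact m) := DFunLike.congr_fun coassoc m
    calc _ = TensorProduct.assoc k C C M ((TensorProduct.comm k C C).toLinearMap.rTensor M
            (Coalgebra.comul.rTensor M (TensorProduct.comm k M C (coact m)))) := by
          rw [LinearMap.rTensor_comp_apply]; rfl
      _ = (TensorProduct.comm k M C).toLinearMap.lTensor C
            (TensorProduct.comm k (M ⊗[k] C) C (coact.rTensor C (coact m))) := by
          rw [LinearMap.rTensor_comm, ← hcoassoc, assoc_rTensor_comm_comm_assoc]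
      _ = _ := by rw [← LinearMap.lTensor_comm, ← LinearMap.lTensor_comp_apply]; rfl
  counit m := (contractFst_comm _ _).trans <|
    (congrArg (TensorProduct.rid k M) (DFunLike.congr_fun counit_coact m)).trans (one_smul k m)

theorem isSubcomodule_iff {K : Submodule k M} :
    IsSubcomodule k C K ↔ (dualAction (opCoact k C M)).IsStable K := by
  rw [IsSubcomodule, Submodule.map_le_iff_le_comap]
  simp only [SetLike.le_def, Submodule.mem_comap, mem_range_rTensor_subtype_iff,
    ← contractFst_comm]
  exact ⟨fun h f _ hm => h hm f, fun h _ hm f => h f hm⟩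

theorem isDistributive_iff :
    IsDistributive k C M ↔ (dualAction (opCoact k C M)).IsDistributive := by
  simp only [IsDistributive, OperatorFamily.IsDistributive, isSubcomodule_iff]

theorem isSimple_iff : IsSimple k C M ↔ (dualAction (opCoact k C M)).IsSimple := by
  simp only [IsSimple, OperatorFamily.IsSimple, isSubcomodule_iff]

theorem isIndecomposable_iff : IsIndecomposable k C M ↔
    Nontrivial M ∧ (dualAction (opCoact k C M)).IsIndecomposable := by
  simp only [IsIndecomposable, OperatorFamily.IsIndecomposable, isSubcomodule_iff]

theorem isColinear_iff {φ : M →ₗ[k] N} : IsColinear k C φ ↔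
    OperatorFamily.Intertwines (dualAction (opCoact k C M)) (dualAction (opCoact k C N)) φ := by
  have hφ : φ.lTensor C ∘ₗ opCoact k C M =
      (TensorProduct.comm k N C).toLinearMap ∘ₗ φ.rTensor C ∘ₗ coact :=
    LinearMap.ext fun m => LinearMap.lTensor_comm _ _
  rw [intertwines_dualAction_iff, hφ, opCoact, LinearMap.comp_assoc,
    LinearMap.cancel_left (TensorProduct.comm k N C).injective, IsColinear]

end RightComodule

section Distributive

variable {k C : Type*} [Field k] [AddCommGroup C] [Module k C] [Coalgebra k C]

theorem isDistributive_coalgebra_iff : Coalgebra.IsDistributive k C ↔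
    (dualAction (Coalgebra.comul (R := k) (A := C))).IsDistributive ∨
      OperatorFamily.IsDistributive (coefficient (Coalgebra.comul (R := k) (A := C))) := by
  rw [← dualAction_comm_comp]
  exact or_congr LeftComodule.isDistributive_iff RightComodule.isDistributive_iff

theorem LeftComodule.HasArrow.iso (hC : Coalgebra.IsDistributive k C) {S T : Type w}
    [AddCommGroup S] [Module k S] [LeftComodule k C S] [AddCommGroup T] [Module k T]
    [LeftComodule k C T] (h : HasArrow k C S T) (hS : IsSimple k C S) (hT : IsSimple k C T) :
    Iso k C S T := by
  obtain ⟨X, _, _, _, f, g, hX, hf, hg, hf_inj, hfg, hg_surj⟩ := h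
  obtain ⟨e, he⟩ := isCoaction.exists_equiv isCoaction isCoaction
    (isDistributive_coalgebra_iff.1 hC) (isSimple_iff.1 hS) (isSimple_iff.1 hT)
    (isIndecomposable_iff.1 hX).2 ⟨isColinear_iff.1 hf, isColinear_iff.1 hg,
      hf_inj, hfg, hg_surj⟩
  exact ⟨e, isColinear_iff.2 he⟩

theorem RightComodule.HasArrow.iso (hC : Coalgebra.IsDistributive k C) {S T : Type w}
    [AddCommGroup S] [Module k S] [RightComodule k C S] [AddCommGroup T] [Module k T]
    [RightComodule k C T] (h : HasArrow k C S T) (hS : IsSimple k C S) (hT : IsSimple k C T) :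
    Iso k C S T := by
  obtain ⟨X, _, _, _, f, g, hX, hf, hg, hf_inj, hfg, hg_surj⟩ := h
  obtain ⟨e, he⟩ := isCoaction.exists_equiv isCoaction isCoaction
    (by simpa only [dualAction_comm_comp, coefficient_comm_comp] using
      (isDistributive_coalgebra_iff.1 hC).symm) (isSimple_iff.1 hS) (isSimple_iff.1 hT)
    (isIndecomposable_iff.1 hX).2 ⟨isColinear_iff.1 hf, isColinear_iff.1 hg,
      hf_inj, hfg, hg_surj⟩
  exact ⟨e, isColinear_iff.2 he⟩

variable {S T : Submodule k C}

theorem isSubcoalgebra_iff : Coalgebra.IsSubcoalgebra S ↔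
    (dualAction (Coalgebra.comul (R := k) (A := C))).IsStable S ∧
      OperatorFamily.IsStable (coefficient (Coalgebra.comul (R := k) (A := C))) S := by
  rw [Coalgebra.IsSubcoalgebra, Submodule.map_le_iff_le_comap]
  simp only [SetLike.le_def, Submodule.mem_comap, mem_range_map_subtype_iff]
  exact ⟨fun h => ⟨fun f _ hx => (h hx).1 f, fun g _ hx => (h hx).2 g⟩,
    fun h _ hx => ⟨fun f => h.1 f hx, fun g => h.2 g hx⟩⟩

theorem disjoint_of_isSimpleSubcoalgebra (hS : Coalgebra.IsSimpleSubcoalgebra S)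
    (hT : Coalgebra.IsSimpleSubcoalgebra T) (hST : S ≠ T) : Disjoint S T := by
  have hinf : Coalgebra.IsSubcoalgebra (S ⊓ T) := by
    have hS' := isSubcoalgebra_iff.1 hS.1
    have hT' := isSubcoalgebra_iff.1 hT.1
    exact isSubcoalgebra_iff.2 ⟨hS'.1.inf hT'.1, hS'.2.inf hT'.2⟩
  rw [disjoint_iff]
  by_contra h0
  have hS_eq := (hS.2.2 _ hinf inf_le_left).resolve_left h0
  have hT_eq := (hT.2.2 _ hinf inf_le_right).resolve_left h0
  exact hST (hS_eq.symm.trans hT_eq)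

theorem le_wedge_left (hT : Coalgebra.IsSubcoalgebra T) (S : Submodule k C) :
    T ≤ Coalgebra.wedge T S := by
  intro x hx
  obtain ⟨z, hz⟩ := hT ⟨x, hx, rfl⟩
  rw [Coalgebra.wedge, LinearMap.mem_ker, LinearMap.comp_apply, ← hz, ← LinearMap.comp_apply,
    ← TensorProduct.map_comp, (LinearMap.exact_subtype_mkQ _).linearMap_comp_eq_zero,
    TensorProduct.map_zero_left, LinearMap.zero_apply]

theorem le_wedge_right (hS : Coalgebra.IsSubcoalgebra S) (T : Submodule k C) :
    S ≤ Coalgebra.wedge T S := by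
  intro x hx
  obtain ⟨z, hz⟩ := hS ⟨x, hx, rfl⟩
  rw [Coalgebra.wedge, LinearMap.mem_ker, LinearMap.comp_apply, ← hz, ← LinearMap.comp_apply,
    ← TensorProduct.map_comp, (LinearMap.exact_subtype_mkQ _).linearMap_comp_eq_zero,
    TensorProduct.map_zero_right, LinearMap.zero_apply]

theorem wedge_eq_sup_of_disjoint (hC : Coalgebra.IsDistributive k C)
    (hS : Coalgebra.IsSubcoalgebra S) (hT : Coalgebra.IsSubcoalgebra T) (hST : Disjoint S T) :
    Coalgebra.wedge T S = S ⊔ T := by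
  refine le_antisymm (fun x hx => ?_) (sup_le (le_wedge_right hS T) (le_wedge_left hT S))
  obtain ⟨hS_left, hS_right⟩ := isSubcoalgebra_iff.1 hS
  obtain ⟨hT_left, hT_right⟩ := isSubcoalgebra_iff.1 hT
  have hleft : IsCoaction _ _ (Coalgebra.comul (R := k) (A := C)) :=
    LeftComodule.isCoaction (M := C)
  have hright : IsCoaction _ _
      ((TensorProduct.comm k C C).toLinearMap ∘ₗ Coalgebra.comul (R := k) (A := C)) :=
    RightComodule.isCoaction (M := C)
  rcases isDistributive_coalgebra_iff.1 hC with hdist | hdist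
  · refine hleft.mem_sup_of_forall_coefficient_mem (fun y => ?_) hdist hT_left hT_right hST
      fun g hg => contractSnd_mem_of_map_mkQ_eq_zero hx hg
    rw [← dualAction_comm_comp]
    exact hright.counit y
  · rw [← dualAction_comm_comp] at hS_right hdist
    rw [← coefficient_comm_comp] at hS_left
    rw [sup_comm]
    refine hright.mem_sup_of_forall_coefficient_mem (fun y => ?_) hdist hS_right hS_left hST.symm
      fun g hg => ?_
    · rw [coefficient_comm_comp]
      exact hleft.counit y
    · rw [coefficient_comm_comp]
      exact contractFst_mem_of_map_mkQ_eq_zero hx hg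

end Distributive

theorem mainTheorem12 (k : Type u) (C : Type v) [Field k] [AddCommGroup C] [Module k C]
    [Coalgebra k C] (hC : Coalgebra.IsDistributive k C) :
    (∀ S T : Coalgebra.QuiverVertex k C, S ≠ T → IsEmpty (S ⟶ T)) ∧
    (∀ (S T : Type w) [AddCommGroup S] [Module k S] [LeftComodule k C S]
      [AddCommGroup T] [Module k T] [LeftComodule k C T],
      LeftComodule.IsSimple k C S → LeftComodule.IsSimple k C T →
        ¬ LeftComodule.Iso k C S T → ¬ LeftComodule.HasArrow k C S T) ∧
    (∀ (S T : Type w) [AddCommGroup S] [Module k S] [RightComodule k C S]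
      [AddCommGroup T] [Module k T] [RightComodule k C T],
      RightComodule.IsSimple k C S → RightComodule.IsSimple k C T →
        ¬ RightComodule.Iso k C S T → ¬ RightComodule.HasArrow k C S T) := by
  refine ⟨fun S T hST => ⟨fun arrow => arrow.down ?_⟩, ?_, ?_⟩
  · have hdisj : Disjoint S.1 T.1 :=
      disjoint_of_isSimpleSubcoalgebra S.2 T.2 (Subtype.coe_ne_coe.2 hST)
    exact wedge_eq_sup_of_disjoint hC S.2.1 T.2.1 hdisj
  · intro S T _ _ _ _ _ _ hS hT hiso harrow
    exact hiso (harrow.iso hC hS hT)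
  · intro S T _ _ _ _ _ _ hS hT hiso harrow
    exact hiso (harrow.iso hC hS hT)
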